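/- \textbf{Conventions.} A name of $f\in C(\mathbb{R})$ is a double sequence $\{P_{k,l}\}_{k,l\in\mathbb{N}}$ of polynomials with rational coefficients such that $\max_{|x|\le 2^l}|f(x)-P_{k,l}(x)|<2^{-k}$ for all $k,l$; $f$ is computable if it has a computable name. A function in $C^1(\mathbb{R})$ is called computable if it is computable as an element of $C(\mathbb{R})$ (that is, the names in $C^1(\mathbb{R})$ are those inherited from $C(\mathbb{R})$). The space $C^1(\mathbb{R})$ carries the uniform $C^1$-topology, given by the metric $d_{C^1}(f,g)=\min\{\|f-g\|_1,1\}$, where $\|h\|_1=\sup_{x\in\mathbb{R}}\max\{|h(x)|,|h'(x)|\}\in[0,\infty]$. The operator $D:C^1(\mathbb{R})\to C(\mathbb{R})$, $f\mapsto f'$, is \emph{robustly non-computable at $f$} if $f$ is computable, $f'$ is not computable, and there is a neighborhood $U$ of $f$ in $C^1(\mathbb{R})$ such that $g'$ is non-computable for every $g\in U$. Let $\phi(x)=e^{-x^2/(1-x^2)}$ for $|x|<1$ and $\phi(x)=0$ for $|x|\ge 1$; let $\psi(x)=\phi(x-\tfrac12)$ and $\psi_k(x)=\tfrac1k\,\psi(k^2x)$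 for $k\ge 2$. \textbf{Theorem.} There exists a function $f\in C^\infty(\mathbb{R})$ such that $f$ is computable and $D:C^1(\mathbb{R})\to C(\mathbb{R})$ is robustly non-computable at $f$. More precisely, there are recursive one-to-one functions $a:\mathbb{N}\to\mathbb{N}$ whose range is a (recursively enumerable) nonrecursive set, and for every such $a$ the series \[ f(x)=\sum_{k=2}^{\infty}\psi_k\bigl(x-a(k)\bigr) \] converges for every $x\in\mathbb{R}$, its sum $f$ is a computable function in $C^\infty(\mathbb{R})$, and $D$ is robustly non-computable at $f$. -/

import Mathlib

open scoped ContDiff Polynomial Topology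

noncomputable section

/-- A represented space: the set `X` with names in `Σ^ℕ`, where `Σ = σ` is a countable alphabet.
`IsName p x` says that the representation is defined at `p` with value `x`; it is a partial
function from `Σ^ℕ` onto `X`. -/
structure NamingSystem (σ : Type*) [Primcodable σ] (X : Type*) where
  /-- `p` is a name of `x` -/
  IsName : (ℕ → σ) → X → Prop
  unique : ∀ p x y, IsName p x → IsName p y → x = y
  onto : ∀ x, ∃ p, IsName p x

namespace NamingSystem

variable {σ : Type*} [Primcodable σ] {X : Type*} {Y : Type*}

/-- An element is computable if it has a computable name. -/
def IsComputable (δ : NamingSystem σ X) (x : X) : Prop :=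
  ∃ p : ℕ → σ, Computable p ∧ δ.IsName p x

/-- The representation of a subspace that is inherited along an injection `i : X → Y`. -/
def restrict (δ : NamingSystem σ Y) (i : X → Y) (hi : Function.Injective i) :
    NamingSystem σ X where
  IsName p x := δ.IsName p (i x)
  unique p _ _ hx hy := hi (δ.unique p _ _ hx hy)
  onto x := δ.onto (i x)

end NamingSystem

/-- `Φ : X → Y` is `τ`-robustly non-computable at the point `xc`: `xc` is computable, `Φ xc` is
not, and some `τ`-neighbourhood of `xc` consists of points `x` with `Φ x` non-computable. -/
structure RobustlyNonComputableAt {σ σ' X Y : Type*} [Primcodable σ] [Primcodable σ']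
    (δX : NamingSystem σ X) (δY : NamingSystem σ' Y) (τ : TopologicalSpace X)
    (Φ : X → Y) (xc : X) : Prop where
  computable_point : δX.IsComputable xc
  noncomputable_value : ¬ δY.IsComputable (Φ xc)
  robust : ∃ U : Set X, IsOpen[τ] U ∧ xc ∈ U ∧ ∀ x ∈ U, ¬ δY.IsComputable (Φ x)

/-- The triple `(a, b, c)` denotes the rational number `(a - b) / (c + 1)`. -/
def ratOfCode (c : ℕ × ℕ × ℕ) : ℚ := ((c.1 : ℚ) - (c.2.1 : ℚ)) / ((c.2.2 : ℚ) + 1)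

/-- The list `[c₀, …, cₙ]` denotes the polynomial `c₀ + c₁ X + ⋯ + cₙ Xⁿ`. -/
def polyOfCode : List (ℕ × ℕ × ℕ) → ℚ[X]
  | [] => 0
  | c :: L => Polynomial.C (ratOfCode c) + Polynomial.X * polyOfCode L

theorem ratOfCode_surjective : Function.Surjective ratOfCode := by
  intro q
  refine ⟨(q.num.toNat, (-q.num).toNat, q.den - 1), ?_⟩
  have h1 : ((q.den - 1 : ℕ) : ℚ) + 1 = q.den := by
    have := q.den_pos
    exact_mod_cast Nat.sub_add_cancel this
  have h2 : ((q.num.toNat : ℕ) : ℚ) - ((-q.num).toNat : ℕ) = q.num := by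
    have : ((q.num.toNat : ℕ) : ℤ) - ((-q.num).toNat : ℕ) = q.num := by omega
    exact_mod_cast this
  simp only [ratOfCode, h1, h2, Rat.num_div_den]

theorem polyOfCode_surjective : Function.Surjective polyOfCode := by
  have key : ∀ n : ℕ, ∀ p : ℚ[X], p.natDegree ≤ n → ∃ L, polyOfCode L = p := by
    intro n
    induction n with
    | zero =>
      intro p hp
      obtain ⟨c, hc⟩ := ratOfCode_surjective (p.coeff 0)
      refine ⟨[c], ?_⟩
      rw [Polynomial.eq_C_of_natDegree_le_zero hp]
      simp [polyOfCode, hc]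
    | succ n ih =>
      intro p hp
      obtain ⟨L, hL⟩ := ih p.divX (by
        rw [Polynomial.natDegree_divX_eq_natDegree_tsub_one]; omega)
      obtain ⟨c, hc⟩ := ratOfCode_surjective (p.coeff 0)
      refine ⟨c :: L, ?_⟩
      rw [polyOfCode, hc, hL, add_comm]
      exact Polynomial.X_mul_divX_add p
  exact fun p => key _ p le_rfl

/-- Rational polynomials are uniformly dense in the real polynomials on a bounded interval. -/
theorem exists_rat_poly_near (p : Polynomial ℝ) (R : ℝ) (hR : 0 ≤ R) :
    ∀ ε : ℝ, 0 < ε → ∃ q : ℚ[X], ∀ x : ℝ, |x| ≤ R → |p.eval x - Polynomial.aeval x q| < ε := by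
  induction p using Polynomial.induction_on' with
  | add p₁ p₂ h₁ h₂ =>
    intro ε hε
    obtain ⟨q₁, hq₁⟩ := h₁ (ε / 2) (half_pos hε)
    obtain ⟨q₂, hq₂⟩ := h₂ (ε / 2) (half_pos hε)
    refine ⟨q₁ + q₂, fun x hx => ?_⟩
    have e : (p₁ + p₂).eval x - Polynomial.aeval x (q₁ + q₂)
        = (p₁.eval x - Polynomial.aeval x q₁) + (p₂.eval x - Polynomial.aeval x q₂) := by
      simp only [Polynomial.eval_add, map_add]; ring
    rw [e]
    have := abs_add_le (p₁.eval x - Polynomial.aeval x q₁) (p₂.eval x - Polynomial.aeval x q₂)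
    linarith [hq₁ x hx, hq₂ x hx]
  | monomial n a =>
    intro ε hε
    have hRn : 0 < R ^ n + 1 := by positivity
    obtain ⟨b, hb₁, hb₂⟩ := exists_rat_btwn (show a - ε / (R ^ n + 1) < a by
      have : 0 < ε / (R ^ n + 1) := by positivity
      linarith)
    refine ⟨Polynomial.monomial n b, fun x hx => ?_⟩
    have e : (Polynomial.monomial n a).eval x
        - Polynomial.aeval x (Polynomial.monomial n b : ℚ[X]) = (a - b) * x ^ n := by
      simp [Polynomial.aeval_monomial]; ring
    rw [e, abs_mul, abs_pow, abs_of_pos (by linarith : (0 : ℝ) < a - b)]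
    have h1 : |x| ^ n < R ^ n + 1 :=
      lt_of_le_of_lt (pow_le_pow_left₀ (abs_nonneg x) hx n) (lt_add_one _)
    have h2 : a - b < ε / (R ^ n + 1) := by linarith
    calc (a - b) * |x| ^ n ≤ (a - b) * (R ^ n + 1) :=
          mul_le_mul_of_nonneg_left h1.le (by linarith)
      _ < ε / (R ^ n + 1) * (R ^ n + 1) := mul_lt_mul_of_pos_right h2 hRn
      _ = ε := div_mul_cancel₀ _ hRn.ne'

/-- The representation of `C(ℝ)`: a name of `f` is (a code of) a double sequence `P k l` of
polynomials with rational coefficients such that `‖f - P k l‖ < 2⁻ᵏ` on `[-2ˡ, 2ˡ]`. The maximum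
norm on the compact interval is spelled out pointwise. -/
def continuousRep : NamingSystem (List (ℕ × ℕ × ℕ)) C(ℝ, ℝ) where
  IsName p f := ∀ k l : ℕ, ∀ x : ℝ, |x| ≤ 2 ^ l →
    |f x - Polynomial.aeval x (polyOfCode (p (Nat.pair k l)))| < (1 / 2) ^ k
  unique p f g hf hg := by
    ext x
    obtain ⟨l, hl⟩ := pow_unbounded_of_one_lt |x| (one_lt_two : (1 : ℝ) < 2)
    by_contra hne
    have hpos : 0 < |f x - g x| / 2 := half_pos (abs_pos.mpr (sub_ne_zero.mpr hne))
    obtain ⟨k, hk⟩ := exists_pow_lt_of_lt_one hpos (by norm_num : (1 / 2 : ℝ) < 1)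
    have h1 := hf k l x hl.le
    have h2 := hg k l x hl.le
    rw [abs_sub_comm] at h2
    have h3 := abs_sub_le (f x) (Polynomial.aeval x (polyOfCode (p (Nat.pair k l)))) (g x)
    linarith
  onto f := by
    have key : ∀ k l : ℕ, ∃ L : List (ℕ × ℕ × ℕ), ∀ x : ℝ, |x| ≤ 2 ^ l →
        |f x - Polynomial.aeval x (polyOfCode L)| < (1 / 2) ^ k := by
      intro k l
      have hε : (0 : ℝ) < (1 / 2) ^ k / 2 := by positivity
      obtain ⟨p, hp⟩ := exists_polynomial_near_of_continuousOn (-2 ^ l) (2 ^ l) f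
        f.continuous.continuousOn _ hε
      obtain ⟨q, hq⟩ := exists_rat_poly_near p (2 ^ l) (by positivity) _ hε
      obtain ⟨L, rfl⟩ := polyOfCode_surjective q
      refine ⟨L, fun x hx => ?_⟩
      have h1 := hp x (by rw [Set.mem_Icc]; exact abs_le.mp hx)
      rw [abs_sub_comm] at h1
      have h3 := abs_sub_le (f x) (p.eval x) (Polynomial.aeval x (polyOfCode L))
      linarith [hq x hx]
    choose P hP using key
    refine ⟨fun n => P n.unpair.1 n.unpair.2, fun k l x hx => ?_⟩
    simpa only [Nat.unpair_pair] using hP k l x hx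

/-- The space `C¹(ℝ)` of continuously differentiable functions `ℝ → ℝ`. -/
def C1R : Type := {f : ℝ → ℝ // ContDiff ℝ 1 f}

namespace C1R

instance : CoeFun C1R (fun _ => ℝ → ℝ) := ⟨Subtype.val⟩

/-- The inclusion of `C¹(ℝ)` in `C(ℝ)`. -/
def toContinuous (f : C1R) : C(ℝ, ℝ) := ⟨f.1, f.2.continuous⟩

theorem toContinuous_injective : Function.Injective toContinuous := fun _ _ h =>
  Subtype.ext (congrArg (fun F : C(ℝ, ℝ) => (F : ℝ → ℝ)) h)

/-- The differentiation operator `D : C¹(ℝ) → C(ℝ)`, `f ↦ f'`. -/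
def D (f : C1R) : C(ℝ, ℝ) := ⟨deriv f.1, f.2.continuous_deriv le_rfl⟩

/-- The (possibly infinite) norm `‖f - g‖₁ = sup_x max(|f x - g x|, |f' x - g' x|)`. -/
def normSub (f g : C1R) : ENNReal :=
  ⨆ x : ℝ, max ‖f x - g x‖ₑ ‖deriv f.1 x - deriv g.1 x‖ₑ

theorem normSub_self (f : C1R) : normSub f f = 0 := by simp [normSub]

theorem normSub_comm (f g : C1R) : normSub f g = normSub g f := by
  simp only [normSub, enorm_sub_rev (f _), enorm_sub_rev (deriv f.1 _)]

theorem normSub_triangle (f g h : C1R) : normSub f h ≤ normSub f g + normSub g h := by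
  have tri : ∀ a b c : ℝ, ‖a - c‖ₑ ≤ ‖a - b‖ₑ + ‖b - c‖ₑ := fun a b c => by
    simpa using enorm_add_le (a - b) (b - c)
  refine iSup_le fun x => ?_
  have h1 := le_iSup (fun x : ℝ => max ‖f x - g x‖ₑ ‖deriv f.1 x - deriv g.1 x‖ₑ) x
  have h2 := le_iSup (fun x : ℝ => max ‖g x - h x‖ₑ ‖deriv g.1 x - deriv h.1 x‖ₑ) x
  refine max_le ((tri _ (g x) _).trans (add_le_add ?_ ?_))
    ((tri _ (deriv g.1 x) _).trans (add_le_add ?_ ?_))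
  · exact (le_max_left _ _).trans h1
  · exact (le_max_left _ _).trans h2
  · exact (le_max_right _ _).trans h1
  · exact (le_max_right _ _).trans h2

theorem eq_of_normSub_eq_zero (f g : C1R) (h : normSub f g = 0) : f = g := by
  refine Subtype.ext (funext fun x => ?_)
  have h1 := le_iSup (fun x : ℝ => max ‖f x - g x‖ₑ ‖deriv f.1 x - deriv g.1 x‖ₑ) x
  have h2 : ‖f x - g x‖ₑ ≤ 0 := ((le_max_left _ _).trans h1).trans h.le
  exact sub_eq_zero.mp (enorm_eq_zero.mp (le_antisymm h2 bot_le))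

/-- The metric `min(‖f - g‖₁, 1)` of `C¹(ℝ)`, which induces its uniform topology. -/
instance : MetricSpace C1R where
  dist f g := (min (normSub f g) 1).toReal
  dist_self f := by simp [normSub_self]
  dist_comm f g := by rw [normSub_comm]
  dist_triangle f g h := by
    have hfin : ∀ a : ENNReal, min a 1 ≠ ⊤ := fun a =>
      ne_top_of_le_ne_top ENNReal.one_ne_top (min_le_right _ _)
    rw [← ENNReal.toReal_add (hfin _) (hfin _)]
    refine ENNReal.toReal_mono (ENNReal.add_ne_top.mpr ⟨hfin _, hfin _⟩) ?_
    rcases le_total (normSub f g) 1 with h1 | h1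
    · rcases le_total (normSub g h) 1 with h2 | h2
      · rw [min_eq_left h1, min_eq_left h2]
        exact (min_le_left _ _).trans (normSub_triangle f g h)
      · rw [min_eq_right h2]
        exact (min_le_right _ _).trans le_add_self
    · rw [min_eq_right h1]
      exact (min_le_right _ _).trans le_self_add
  eq_of_dist_eq_zero := by
    intro f g h
    refine eq_of_normSub_eq_zero f g ?_
    rcases (ENNReal.toReal_eq_zero_iff _).mp h with h0 | h0
    · rcases min_eq_iff.mp h0 with h1 | h1
      · exact h1.1
      · exact absurd h1.1 one_ne_zero
    · exact absurd h0 (ne_top_of_le_ne_top ENNReal.one_ne_top (min_le_right _ _))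

/-- `C¹(ℝ)` as a subspace of the represented space `C(ℝ)`: names are approximations of the
function values only, so that "computable" means computable as a real function. -/
def rep : NamingSystem (List (ℕ × ℕ × ℕ)) C1R :=
  continuousRep.restrict toContinuous toContinuous_injective

end C1R

/-- The canonical bump function `φ`. -/
def bump (x : ℝ) : ℝ := if |x| < 1 then Real.exp (-(x ^ 2 / (1 - x ^ 2))) else 0

/-- `ψ_k(x) = (1/k) ψ(k² x)`, where `ψ(x) = φ(x - 1/2)`. -/
def scaledBump (k : ℕ) (x : ℝ) : ℝ := 1 / (k : ℝ) * bump ((k : ℝ) ^ 2 * x - 1 / 2)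

/-- `a` is a recursive one-to-one enumeration of a (hence r.e.) nonrecursive set. -/
structure IsInjEnumOfNonrecursive (a : ℕ → ℕ) : Prop where
  computable : Computable a
  injective : Function.Injective a
  nonrecursive : ¬ ComputablePred (fun n : ℕ => n ∈ Set.range a)

end

/-!
The bumps `ψ_k (x - a k)` have disjoint supports, each inside the interval of radius `3/8` around
the integer `a k`. Hence the sum `f` is locally a single bump or zero, and is smooth. The height
`1 / k` of a bump tends to `0` at a known rate while its slope at `a k` is at least `k`, so the
values of `f` can be computed but those of `f'` cannot.

* `f` is computable (`exists_computable_name_bumpSum`). By disjointness of supports, a partial sum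
  with `N` terms is within `1 / (N + 2)` of `f` on the whole line (`abs_bumpSum_sub_sum_le`). A
  single bump is replaced on `[-2ˡ, 2ˡ]` by a Bernstein polynomial: the variance identity for
  Bernstein polynomials gives an explicit rate for Lipschitz functions (`abs_sub_bernstein_le`), and
  the values at the nodes are approximated by rational numbers through
  `exp (-y) ≈ (1 + y / m)⁻ᵐ`, with an error that does not depend on `y` (`abs_bump_sub_le`). The
  Lipschitz constant of the bump enters only as some natural number. That codes of these polynomials
  can be computed follows from the closure properties of `PolyComputable`.
* `f'` is at least `2` at each `a k` with `k ≥ 2` and `0` at all other natural numbers. If the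
  `C¹`-distance of `g` and `f` is less than `1/2`, the values of `g'` at the natural numbers therefore
  stay away from `1` by more than `1/4`, on the side that tells whether `n = a k` for some `k ≥ 2`. So
  a computable `g'` would decide the range of `a` (`computablePred_of_separated`,
  `not_isComputable_D_of_dist_lt`).
* A nonrecursive set with a one-to-one enumeration consists of the numbers `2 e`, for `e` a halting
  program, and some odd numbers: `⟨e, t⟩` is sent to `2 e` if `e` halts at stage `t` and not earlier,
  and to the odd number `2 ⟨e, t⟩ + 1` otherwise (`exists_injEnumOfNonrecursive`).
-/

/-! ### Natural number functions -/

theorem Computable.nat_add' {α : Type*} [Primcodable α] {f g : α → ℕ} (hf : Computable f)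
    (hg : Computable g) : Computable fun x => f x + g x :=
  Primrec.nat_add.to_comp.comp hf hg

theorem Computable.nat_mul' {α : Type*} [Primcodable α] {f g : α → ℕ} (hf : Computable f)
    (hg : Computable g) : Computable fun x => f x * g x :=
  Primrec.nat_mul.to_comp.comp hf hg

theorem Computable.nat_sub' {α : Type*} [Primcodable α] {f g : α → ℕ} (hf : Computable f)
    (hg : Computable g) : Computable fun x => f x - g x :=
  Primrec.nat_sub.to_comp.comp hf hg

theorem Computable.nat_pow' {α : Type*} [Primcodable α] {f g : α → ℕ} (hf : Computable f)
    (hg : Computable g) : Computable fun x => f x ^ g x :=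
  (Primrec₂.unpaired'.1 Nat.Primrec.pow).to_comp.comp hf hg

theorem Primrec.nat_factorial : Primrec Nat.factorial :=
  (Primrec.nat_rec₁ (f := fun n m => (n + 1) * m) 1
    (Primrec.nat_mul.comp (Primrec.succ.comp Primrec.fst) Primrec.snd)).of_eq fun n => by
      induction n with
      | zero => rfl
      | succ n ih => simp only [ih, Nat.factorial_succ]

theorem Computable.nat_choose' {α : Type*} [Primcodable α] {f g : α → ℕ} (hf : Computable f)
    (hg : Computable g) : Computable fun x => (f x).choose (g x) :=
  -- The first factor is `0` when `f x < g x` and `1` otherwise.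
  (((Computable.const 1).nat_sub' (hg.nat_sub' hf)).nat_mul'
    (Primrec.nat_div.to_comp.comp (Primrec.nat_factorial.to_comp.comp hf)
      ((Primrec.nat_factorial.to_comp.comp hg).nat_mul'
        (Primrec.nat_factorial.to_comp.comp (hf.nat_sub' hg))))).of_eq fun x => by
    rcases le_or_gt (g x) (f x) with h | h
    · rw [Nat.choose_eq_factorial_div_factorial h, Nat.sub_eq_zero_of_le h, Nat.sub_zero, one_mul]
    · rw [Nat.choose_eq_zero_of_lt h, show 1 - (g x - f x) = 0 by omega, zero_mul]

/-! ### Arithmetic on codes of rational numbers and polynomials -/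

/-- Addition on codes of rational numbers. -/
def addCode (c d : ℕ × ℕ × ℕ) : ℕ × ℕ × ℕ :=
  (c.1 * (d.2.2 + 1) + d.1 * (c.2.2 + 1), c.2.1 * (d.2.2 + 1) + d.2.1 * (c.2.2 + 1),
    (c.2.2 + 1) * (d.2.2 + 1) - 1)

/-- Multiplication on codes of rational numbers. -/
def mulCode (c d : ℕ × ℕ × ℕ) : ℕ × ℕ × ℕ :=
  (c.1 * d.1 + c.2.1 * d.2.1, c.1 * d.2.1 + c.2.1 * d.1, (c.2.2 + 1) * (d.2.2 + 1) - 1)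

theorem denominator_code (m n : ℕ) :
    (((m + 1) * (n + 1) - 1 : ℕ) : ℚ) + 1 = ((m : ℚ) + 1) * (n + 1) := by
  exact_mod_cast Nat.sub_add_cancel (Nat.mul_pos m.succ_pos n.succ_pos)

theorem ratOfCode_addCode (c d : ℕ × ℕ × ℕ) :
    ratOfCode (addCode c d) = ratOfCode c + ratOfCode d := by
  simp only [ratOfCode, addCode, denominator_code]
  push_cast
  field_simp
  ring

theorem ratOfCode_mulCode (c d : ℕ × ℕ × ℕ) :
    ratOfCode (mulCode c d) = ratOfCode c * ratOfCode d := by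
  simp only [ratOfCode, mulCode, denominator_code]
  push_cast
  field_simp
  ring

theorem primrec_addCode : Primrec₂ addCode := by
  have c1 : Primrec fun p : (ℕ × ℕ × ℕ) × (ℕ × ℕ × ℕ) => p.1.1 := Primrec.fst.comp Primrec.fst
  have c2 : Primrec fun p : (ℕ × ℕ × ℕ) × (ℕ × ℕ × ℕ) => p.1.2.1 :=
    Primrec.fst.comp (Primrec.snd.comp Primrec.fst)
  have c3 : Primrec fun p : (ℕ × ℕ × ℕ) × (ℕ × ℕ × ℕ) => p.1.2.2 + 1 :=
    Primrec.succ.comp (Primrec.snd.comp (Primrec.snd.comp Primrec.fst))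
  have d1 : Primrec fun p : (ℕ × ℕ × ℕ) × (ℕ × ℕ × ℕ) => p.2.1 := Primrec.fst.comp Primrec.snd
  have d2 : Primrec fun p : (ℕ × ℕ × ℕ) × (ℕ × ℕ × ℕ) => p.2.2.1 :=
    Primrec.fst.comp (Primrec.snd.comp Primrec.snd)
  have d3 : Primrec fun p : (ℕ × ℕ × ℕ) × (ℕ × ℕ × ℕ) => p.2.2.2 + 1 :=
    Primrec.succ.comp (Primrec.snd.comp (Primrec.snd.comp Primrec.snd))
  exact Primrec.pair (Primrec.nat_add.comp (Primrec.nat_mul.comp c1 d3) (Primrec.nat_mul.comp d1 c3))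
    (Primrec.pair
      (Primrec.nat_add.comp (Primrec.nat_mul.comp c2 d3) (Primrec.nat_mul.comp d2 c3))
      (Primrec.nat_sub.comp (Primrec.nat_mul.comp c3 d3) (Primrec.const 1)))

theorem primrec_mulCode : Primrec₂ mulCode := by
  have c1 : Primrec fun p : (ℕ × ℕ × ℕ) × (ℕ × ℕ × ℕ) => p.1.1 := Primrec.fst.comp Primrec.fst
  have c2 : Primrec fun p : (ℕ × ℕ × ℕ) × (ℕ × ℕ × ℕ) => p.1.2.1 :=
    Primrec.fst.comp (Primrec.snd.comp Primrec.fst)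
  have c3 : Primrec fun p : (ℕ × ℕ × ℕ) × (ℕ × ℕ × ℕ) => p.1.2.2 + 1 :=
    Primrec.succ.comp (Primrec.snd.comp (Primrec.snd.comp Primrec.fst))
  have d1 : Primrec fun p : (ℕ × ℕ × ℕ) × (ℕ × ℕ × ℕ) => p.2.1 := Primrec.fst.comp Primrec.snd
  have d2 : Primrec fun p : (ℕ × ℕ × ℕ) × (ℕ × ℕ × ℕ) => p.2.2.1 :=
    Primrec.fst.comp (Primrec.snd.comp Primrec.snd)
  have d3 : Primrec fun p : (ℕ × ℕ × ℕ) × (ℕ × ℕ × ℕ) => p.2.2.2 + 1 :=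
    Primrec.succ.comp (Primrec.snd.comp (Primrec.snd.comp Primrec.snd))
  exact Primrec.pair (Primrec.nat_add.comp (Primrec.nat_mul.comp c1 d1) (Primrec.nat_mul.comp c2 d2))
    (Primrec.pair
      (Primrec.nat_add.comp (Primrec.nat_mul.comp c1 d2) (Primrec.nat_mul.comp c2 d1))
      (Primrec.nat_sub.comp (Primrec.nat_mul.comp c3 d3) (Primrec.const 1)))

/-- Evaluation of a coded polynomial at a coded rational number, by Horner's scheme. -/
def evalCode (L : List (ℕ × ℕ × ℕ)) (q : ℕ × ℕ × ℕ) : ℕ × ℕ × ℕ :=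
  L.foldr (fun c acc => addCode c (mulCode q acc)) (0, 0, 0)

theorem ratOfCode_evalCode (L : List (ℕ × ℕ × ℕ)) (q : ℕ × ℕ × ℕ) :
    ratOfCode (evalCode L q) = (polyOfCode L).eval (ratOfCode q) := by
  induction L with
  | nil => simp [evalCode, polyOfCode, ratOfCode]
  | cons c L ih =>
    simp only [evalCode, List.foldr_cons] at ih ⊢
    rw [ratOfCode_addCode, ratOfCode_mulCode, ih]
    simp [polyOfCode]

theorem primrec_evalCode : Primrec₂ evalCode :=
  Primrec.list_foldr (f := fun p : List (ℕ × ℕ × ℕ) × (ℕ × ℕ × ℕ) => p.1)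
    (h := fun p s => addCode s.1 (mulCode p.2 s.2)) Primrec.fst (Primrec.const (0, 0, 0))
    (primrec_addCode.comp (Primrec.fst.comp Primrec.snd)
      (primrec_mulCode.comp (Primrec.snd.comp Primrec.fst) (Primrec.snd.comp Primrec.snd)))

/-- Multiplication of a coded polynomial by a coded rational number. -/
def polySMulCode (c : ℕ × ℕ × ℕ) (L : List (ℕ × ℕ × ℕ)) : List (ℕ × ℕ × ℕ) := L.map (mulCode c)

theorem polyOfCode_polySMulCode (c : ℕ × ℕ × ℕ) (L : List (ℕ × ℕ × ℕ)) :
    polyOfCode (polySMulCode c L) = Polynomial.C (ratOfCode c) * polyOfCode L := by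
  induction L with
  | nil => simp [polySMulCode, polyOfCode]
  | cons d L ih =>
    simp only [polySMulCode, List.map_cons, polyOfCode] at ih ⊢
    rw [ih, ratOfCode_mulCode, Polynomial.C_mul]
    ring

theorem primrec_polySMulCode : Primrec₂ polySMulCode :=
  Primrec.list_map (g := fun (p : (ℕ × ℕ × ℕ) × List (ℕ × ℕ × ℕ)) d => mulCode p.1 d) Primrec.snd
    (primrec_mulCode.comp (Primrec.fst.comp Primrec.fst) Primrec.snd)

theorem coeff_polyOfCode (L : List (ℕ × ℕ × ℕ)) (i : ℕ) :
    (polyOfCode L).coeff i = ratOfCode (L.getD i (0, 0, 0)) := by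
  induction L generalizing i with
  | nil => simp [polyOfCode, ratOfCode]
  | cons c L ih => cases i <;> simp [polyOfCode, ih, Polynomial.coeff_C]

/-- Addition of coded polynomials, coefficient by coefficient. -/
def polyAddCode (L M : List (ℕ × ℕ × ℕ)) : List (ℕ × ℕ × ℕ) :=
  (List.range (L.length + M.length)).map
    fun i => addCode (L.getD i (0, 0, 0)) (M.getD i (0, 0, 0))

theorem polyOfCode_polyAddCode (L M : List (ℕ × ℕ × ℕ)) :
    polyOfCode (polyAddCode L M) = polyOfCode L + polyOfCode M := by
  ext i
  rw [Polynomial.coeff_add, coeff_polyOfCode, coeff_polyOfCode, coeff_polyOfCode,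
    ← ratOfCode_addCode]
  rcases lt_or_ge i (L.length + M.length) with h | h
  · simp [polyAddCode, List.getD_eq_getElem?_getD, h]
  · have hL : L.length ≤ i := by omega
    have hM : M.length ≤ i := by omega
    simp [polyAddCode, List.getD_eq_getElem?_getD, h, hL, hM, addCode]

theorem primrec_polyAddCode : Primrec₂ polyAddCode :=
  Primrec.list_map
    (g := fun (p : List (ℕ × ℕ × ℕ) × List (ℕ × ℕ × ℕ)) i =>
      addCode (p.1.getD i (0, 0, 0)) (p.2.getD i (0, 0, 0)))
    (Primrec.list_range.comp (Primrec.nat_add.comp (Primrec.list_length.comp Primrec.fst)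
      (Primrec.list_length.comp Primrec.snd)))
    (primrec_addCode.comp
      ((Primrec.list_getD (0, 0, 0)).comp (Primrec.fst.comp Primrec.fst) Primrec.snd)
      ((Primrec.list_getD (0, 0, 0)).comp (Primrec.snd.comp Primrec.fst) Primrec.snd))

/-- Multiplication of coded polynomials, by Horner's scheme. -/
def polyMulCode (L M : List (ℕ × ℕ × ℕ)) : List (ℕ × ℕ × ℕ) :=
  L.foldr (fun c acc => polyAddCode (polySMulCode c M) ((0, 0, 0) :: acc)) []

theorem polyOfCode_polyMulCode (L M : List (ℕ × ℕ × ℕ)) :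
    polyOfCode (polyMulCode L M) = polyOfCode L * polyOfCode M := by
  induction L with
  | nil => simp [polyMulCode, polyOfCode]
  | cons c L ih =>
    simp only [polyMulCode, List.foldr_cons] at ih ⊢
    rw [polyOfCode_polyAddCode, polyOfCode_polySMulCode, polyOfCode, ih]
    simp [polyOfCode, ratOfCode]
    ring

theorem primrec_polyMulCode : Primrec₂ polyMulCode :=
  Primrec.list_foldr (f := fun p : List (ℕ × ℕ × ℕ) × List (ℕ × ℕ × ℕ) => p.1)
    (h := fun p s => polyAddCode (polySMulCode s.1 p.2) ((0, 0, 0) :: s.2)) Primrec.fst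
    (Primrec.const [])
    (primrec_polyAddCode.comp
      (primrec_polySMulCode.comp (Primrec.fst.comp Primrec.snd) (Primrec.snd.comp Primrec.fst))
      (Primrec.list_cons.comp (Primrec.const (0, 0, 0)) (Primrec.snd.comp Primrec.snd)))

/-! ### Computable families of rational polynomials -/

/-- A family of rational polynomials is computable if codes of its members can be computed. -/
def PolyComputable {α : Type*} [Primcodable α] (F : α → ℚ[X]) : Prop :=
  ∃ c : α → List (ℕ × ℕ × ℕ), Computable c ∧ ∀ x, polyOfCode (c x) = F x

namespace PolyComputable

variable {α : Type*} [Primcodable α] {F G : α → ℚ[X]}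

theorem add (hF : PolyComputable F) (hG : PolyComputable G) :
    PolyComputable fun x => F x + G x := by
  obtain ⟨c, hc, hcF⟩ := hF
  obtain ⟨d, hd, hdG⟩ := hG
  exact ⟨_, primrec_polyAddCode.to_comp.comp hc hd, fun x => by
    rw [polyOfCode_polyAddCode, hcF, hdG]⟩

theorem mul (hF : PolyComputable F) (hG : PolyComputable G) :
    PolyComputable fun x => F x * G x := by
  obtain ⟨c, hc, hcF⟩ := hF
  obtain ⟨d, hd, hdG⟩ := hG
  exact ⟨_, primrec_polyMulCode.to_comp.comp hc hd, fun x => by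
    rw [polyOfCode_polyMulCode, hcF, hdG]⟩

theorem const (p : ℚ[X]) : PolyComputable fun _ : α => p := by
  obtain ⟨L, hL⟩ := polyOfCode_surjective p
  exact ⟨fun _ => L, Computable.const L, fun _ => hL⟩

theorem natDiv {u v : α → ℕ} (hu : Computable u) (hv : Computable v) (h0 : ∀ x, v x ≠ 0) :
    PolyComputable fun x => Polynomial.C ((u x : ℚ) / (v x : ℚ)) := by
  refine ⟨fun x => [(u x, 0, v x - 1)], ?_, fun x => ?_⟩
  · exact Computable.list_cons.comp
      (hu.pair ((Computable.const 0).pair (hv.nat_sub' (Computable.const 1))))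
      (Computable.const [])
  · have : ((v x - 1 : ℕ) : ℚ) + 1 = v x := by
      exact_mod_cast Nat.sub_add_cancel (Nat.pos_of_ne_zero (h0 x))
    simp [polyOfCode, ratOfCode, this]

theorem pow (hF : PolyComputable F) {n : α → ℕ} (hn : Computable n) :
    PolyComputable fun x => F x ^ n x := by
  obtain ⟨c, hc, hcF⟩ := hF
  obtain ⟨e, he⟩ := polyOfCode_surjective 1
  refine ⟨_, Computable.nat_rec (h := fun x s => polyMulCode s.2 (c x)) hn (Computable.const e)
    (primrec_polyMulCode.to_comp.comp (Computable.snd.comp Computable.snd)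
      (hc.comp Computable.fst)), fun x => ?_⟩
  simp only
  induction n x with
  | zero => simp [he]
  | succ k ih => simp only [polyOfCode_polyMulCode, ih, hcF, pow_succ]

theorem sum {H : α → ℕ → ℚ[X]} (hH : PolyComputable fun s : α × ℕ => H s.1 s.2) {n : α → ℕ}
    (hn : Computable n) : PolyComputable fun x => ∑ i ∈ Finset.range (n x), H x i := by
  obtain ⟨c, hc, hcH⟩ := hH
  refine ⟨_, Computable.nat_rec (h := fun x s => polyAddCode s.2 (c (x, s.1))) hn
    (Computable.const []) (primrec_polyAddCode.to_comp.comp (Computable.snd.comp Computable.snd)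
      (hc.comp (Computable.fst.pair (Computable.fst.comp Computable.snd)))), fun x => ?_⟩
  simp only
  induction n x with
  | zero => simp [polyOfCode]
  | succ k ih => simp only [polyOfCode_polyAddCode, ih, hcH, Finset.sum_range_succ]

end PolyComputable

/-! ### A one-to-one enumeration of a nonrecursive set -/

open Nat.Partrec in
theorem exists_injEnumOfNonrecursive : ∃ a : ℕ → ℕ, IsInjEnumOfNonrecursive a := by
  classical
  let run : ℕ → ℕ → Bool := fun e t => (Code.evaln t (Denumerable.ofNat Code e) 0).isSome
  have hrun : Primrec₂ run := Primrec.option_isSome.comp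
    (Code.primrec_evaln.comp (Primrec.pair (Primrec.pair Primrec.snd
      ((Primrec.ofNat Code).comp Primrec.fst)) (Primrec.const 0)))
  have mono : ∀ e s t, s ≤ t → run e s = true → run e t = true := by
    intro e s t hst h
    obtain ⟨y, hy⟩ := Option.isSome_iff_exists.mp h
    exact Option.isSome_iff_exists.mpr ⟨y, Code.evaln_mono hst hy⟩
  -- `first n` says that, for `n = ⟨e, t⟩`, the evaluation of program `e` on input `0`
  -- succeeds with step bound `t + 1` but not with `t`.
  let first : ℕ → Bool := fun n => run n.unpair.1 (n.unpair.2 + 1) && !run n.unpair.1 n.unpair.2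
  have hu1 : Primrec fun n : ℕ => n.unpair.1 := Primrec.fst.comp Primrec.unpair
  have hu2 : Primrec fun n : ℕ => n.unpair.2 := Primrec.snd.comp Primrec.unpair
  have hfirst : Primrec first := Primrec.and.comp (hrun.comp hu1 (Primrec.succ.comp hu2))
    (Primrec.not.comp (hrun.comp hu1 hu2))
  -- Each halting program is listed once, at its halting time; odd numbers fill the gaps.
  let a : ℕ → ℕ := fun n => bif first n then 2 * n.unpair.1 else 2 * n + 1
  have ha : Primrec a := Primrec.cond hfirst (Primrec.nat_double.comp hu1) Primrec.nat_double_succ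
  have unique : ∀ e s t, run e (s + 1) = true → run e t = false → t ≤ s := by
    intro e s t h1 h2
    by_contra h
    rw [mono e (s + 1) t (by omega) h1] at h2
    cases h2
  refine ⟨a, ha.to_comp, fun m n h => ?_, fun hrec => ?_⟩
  · cases hm : first m <;> cases hn : first n <;> simp only [a, hm, hn, cond_true, cond_false] at h
    · omega
    · omega
    · omega
    · simp only [first, Bool.and_eq_true, Bool.not_eq_true'] at hm hn
      have he : m.unpair.1 = n.unpair.1 := by omega
      rw [he] at hm
      have h1 := unique _ _ _ hm.1 hn.2
      have h2 := unique _ _ _ hn.1 hm.2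
      rw [← Nat.pair_unpair m, ← Nat.pair_unpair n, he, le_antisymm h2 h1]
  · refine ComputablePred.halting_problem 0 (ComputablePred.of_eq (p := fun c : Code =>
      2 * Encodable.encode c ∈ Set.range a) ?_ fun c => ?_)
    · obtain ⟨f, hf, hfe⟩ := ComputablePred.computable_iff.1 hrec
      refine ComputablePred.computable_iff.2 ⟨fun c => f (2 * Encodable.encode c),
        hf.comp (Primrec.nat_double.comp Primrec.encode).to_comp, funext fun c => ?_⟩
      exact congrFun hfe (2 * Encodable.encode c)
    · have hcode : ∀ t, run (Encodable.encode c) t = (Code.evaln t c 0).isSome := fun t => by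
        simp [run]
      constructor
      · rintro ⟨n, hn⟩
        cases h : first n <;> simp only [a, h, cond_true, cond_false] at hn
        · omega
        · simp only [first, Bool.and_eq_true] at h
          rw [show n.unpair.1 = Encodable.encode c by omega, hcode] at h
          obtain ⟨y, hy⟩ := Option.isSome_iff_exists.mp h.1
          exact Part.dom_iff_mem.mpr ⟨y, Code.evaln_sound hy⟩
      · intro hdom
        obtain ⟨y, hy⟩ := Part.dom_iff_mem.mp hdom
        obtain ⟨t, ht⟩ := Code.evaln_complete.mp hy
        have hex : ∃ t, run (Encodable.encode c) t = true :=
          ⟨t, by rw [hcode]; exact Option.isSome_iff_exists.mpr ⟨y, ht⟩⟩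
        have h0 : Nat.find hex ≠ 0 := fun h => by
          have := Nat.find_spec hex
          rw [h, hcode] at this
          simp [Code.evaln] at this
        obtain ⟨s, hs⟩ := Nat.exists_eq_succ_of_ne_zero h0
        have h1 : run (Encodable.encode c) (s + 1) = true := by
          rw [← Nat.succ_eq_add_one, ← hs]
          exact Nat.find_spec hex
        have h2 : run (Encodable.encode c) s = false := by
          simpa using Nat.find_min hex (m := s) (by omega)
        exact ⟨Nat.pair (Encodable.encode c) s, by simp [a, first, h1, h2]⟩

/-! ### The bump function -/

theorem bump_eq_expNegInvGlue (x : ℝ) : bump x = Real.exp 1 * expNegInvGlue (1 - x ^ 2) := by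
  unfold bump expNegInvGlue
  by_cases h : |x| < 1
  · have hx : 0 < 1 - x ^ 2 := by nlinarith [sq_abs x, abs_nonneg x]
    rw [if_pos h, if_neg hx.not_ge, ← Real.exp_add]
    congr 1
    field_simp
    ring
  · have hx : 1 - x ^ 2 ≤ 0 := by nlinarith [sq_abs x, abs_nonneg x]
    rw [if_neg h, if_pos hx, mul_zero]

theorem contDiff_bump : ContDiff ℝ ∞ bump := by
  rw [funext bump_eq_expNegInvGlue]
  exact contDiff_const.mul (expNegInvGlue.contDiff.comp (contDiff_const.sub (contDiff_id.pow 2)))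

theorem bump_nonneg (x : ℝ) : 0 ≤ bump x := by
  unfold bump
  split_ifs <;> positivity

theorem bump_le_one (x : ℝ) : bump x ≤ 1 := by
  unfold bump
  split_ifs with h
  · have hx : 0 < 1 - x ^ 2 := by nlinarith [sq_abs x, abs_nonneg x]
    rw [Real.exp_le_one_iff, neg_nonpos]
    positivity
  · exact zero_le_one

theorem bump_eq_zero {x : ℝ} (hx : 1 ≤ |x|) : bump x = 0 := if_neg hx.not_gt

theorem exists_lipschitz_bump : ∃ K : ℕ, 0 < K ∧ ∀ x y, |bump x - bump y| ≤ K * |x - y| := by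
  have hc : HasCompactSupport bump := HasCompactSupport.intro (isCompact_Icc (a := -1) (b := 1))
    fun x hx => bump_eq_zero (by
      by_contra h
      exact hx (Set.mem_Icc.mpr (abs_le.mp (not_le.mp h).le)))
  obtain ⟨C, hC⟩ := contDiff_bump.lipschitzWith_of_hasCompactSupport hc (by simp)
  obtain ⟨K, hK⟩ := exists_nat_gt (C : ℝ)
  refine ⟨K, by exact_mod_cast C.coe_nonneg.trans_lt hK, fun x y => ?_⟩
  have h := hC.dist_le_mul x y
  rw [Real.dist_eq, Real.dist_eq] at h
  exact h.trans (mul_le_mul_of_nonneg_right hK.le (abs_nonneg _))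

/-- The slope of `bump` at `-1/2`, which is the slope of `scaledBump k` at `0` up to the factor
`k`. -/
theorem exists_hasDerivAt_bump : ∃ c : ℝ, 1 ≤ c ∧ HasDerivAt bump c (-(1 / 2)) := by
  refine ⟨Real.exp (-(1 / 3)) * (16 / 9), ?_, ?_⟩
  · have := Real.add_one_le_exp (-(1 / 3 : ℝ))
    linarith
  · have h1 : HasDerivAt (fun x : ℝ => x ^ 2) (2 * (-(1 / 2))) (-(1 / 2)) := by
      simpa using hasDerivAt_pow 2 (-(1 / 2) : ℝ)
    have h2 := ((h1.div (h1.const_sub 1) (by norm_num)).neg).exp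
    refine (h2.congr_of_eventuallyEq ?_).congr_deriv ?_
    · filter_upwards [isOpen_lt continuous_abs continuous_const |>.mem_nhds
        (show |(-(1 / 2) : ℝ)| < 1 by norm_num [abs_of_pos])] with x hx
      exact if_pos hx
    · simp only [Pi.neg_apply, Pi.div_apply]
      norm_num

theorem contDiff_scaledBump (k : ℕ) : ContDiff ℝ ∞ (scaledBump k) :=
  contDiff_const.mul (contDiff_bump.comp ((contDiff_const.mul contDiff_id).sub contDiff_const))

theorem scaledBump_nonneg (k : ℕ) (x : ℝ) : 0 ≤ scaledBump k x :=
  mul_nonneg (by positivity) (bump_nonneg _)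

theorem scaledBump_le (k : ℕ) (x : ℝ) : scaledBump k x ≤ 1 / k :=
  mul_le_of_le_one_right (by positivity) (bump_le_one _)

theorem scaledBump_eq_zero {k : ℕ} (hk : 2 ≤ k) {x : ℝ} (hx : 3 / 8 ≤ |x|) :
    scaledBump k x = 0 := by
  have hk' : (2 : ℝ) ≤ k := by exact_mod_cast hk
  have h4 : (4 : ℝ) ≤ (k : ℝ) ^ 2 := by nlinarith
  rw [scaledBump, bump_eq_zero, mul_zero]
  rw [le_abs] at hx ⊢
  rcases hx with h | h
  · left; nlinarith
  · right; nlinarith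

theorem hasDerivAt_scaledBump {c : ℝ} (hc : HasDerivAt bump c (-(1 / 2))) {k : ℕ} (hk : k ≠ 0) :
    HasDerivAt (scaledBump k) (k * c) 0 := by
  have h1 : HasDerivAt (fun x : ℝ => (k : ℝ) ^ 2 * x - 1 / 2) ((k : ℝ) ^ 2) 0 := by
    simpa using ((hasDerivAt_id (0 : ℝ)).const_mul ((k : ℝ) ^ 2)).sub_const (1 / 2)
  have h2 : HasDerivAt bump c ((k : ℝ) ^ 2 * 0 - 1 / 2) := by simpa using hc
  refine ((h2.comp (0 : ℝ) h1).const_mul (1 / (k : ℝ))).congr_deriv ?_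
  have : (k : ℝ) ≠ 0 := by exact_mod_cast hk
  field_simp

theorem scaledBump_lipschitz {K : ℕ} (hK : ∀ x y, |bump x - bump y| ≤ K * |x - y|) (k : ℕ)
    (x y : ℝ) : |scaledBump k x - scaledBump k y| ≤ K * k * |x - y| := by
  rcases Nat.eq_zero_or_pos k with rfl | hk
  · simp [scaledBump]
  have hk' : (0 : ℝ) < k := by exact_mod_cast hk
  have h := hK ((k : ℝ) ^ 2 * x - 1 / 2) ((k : ℝ) ^ 2 * y - 1 / 2)
  rw [show (k : ℝ) ^ 2 * x - 1 / 2 - ((k : ℝ) ^ 2 * y - 1 / 2) = (k : ℝ) ^ 2 * (x - y) by ring,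
    abs_mul, abs_of_pos (by positivity : (0 : ℝ) < (k : ℝ) ^ 2)] at h
  rw [scaledBump, scaledBump, ← mul_sub, abs_mul, abs_of_pos (by positivity : 0 < 1 / (k : ℝ))]
  calc 1 / (k : ℝ) * _ ≤ 1 / (k : ℝ) * (K * ((k : ℝ) ^ 2 * |x - y|)) := by gcongr
    _ = K * k * |x - y| := by field_simp

/-- With `z = y / m`, the left-hand side compares `(1 + y / m)⁻ᵐ` with `exp (-y)`; the bound does
not depend on `y`. -/
theorem abs_inv_one_add_pow_sub_exp_le {z : ℝ} (hz : 0 ≤ z) {m : ℕ} (hm : 2 ≤ m) :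
    |Real.exp (-(m * z)) - (1 / (1 + z)) ^ m| ≤ 2 / ((m : ℝ) - 1) := by
  have hm' : (2 : ℝ) ≤ m := by exact_mod_cast hm
  have hexp : Real.exp (-(m * z)) = Real.exp (-z) ^ m := by
    rw [← Real.exp_nat_mul]; ring_nf
  have h1 : Real.exp (-z) ≤ 1 / (1 + z) := by
    rw [Real.exp_neg, ← one_div]
    exact one_div_le_one_div_of_le (by positivity) (by linarith [Real.add_one_le_exp z])
  have h2 : Real.exp (-z) ^ m ≤ (1 / (1 + z)) ^ m := pow_le_pow_left₀ (Real.exp_pos _).le h1 m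
  rw [hexp, abs_sub_comm, abs_of_nonneg (by linarith)]
  have h3 : 1 / (1 + z) - Real.exp (-z) ≤ 1 / (1 + z) * z ^ 2 := by
    have h := Real.add_one_le_exp (-z)
    have : 1 / (1 + z) - 1 / (1 + z) * z ^ 2 = 1 - z := by field_simp; ring
    linarith
  have h4 : (1 / (1 + z)) ^ m - Real.exp (-z) ^ m
      ≤ m * (1 / (1 + z)) ^ (m - 1) * (1 / (1 + z) - Real.exp (-z)) := by
    have hb := one_add_mul_le_pow (a := Real.exp (-z) / (1 / (1 + z)) - 1)
      (by have : 0 ≤ Real.exp (-z) / (1 / (1 + z)) := by positivity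
          linarith) m
    have hpos : 0 < 1 / (1 + z) := by positivity
    set b := 1 / (1 + z)
    rw [add_sub_cancel, div_pow, le_div_iff₀ (by positivity)] at hb
    have hbm : b ^ m = b ^ (m - 1) * b := by rw [← pow_succ, Nat.sub_add_cancel (by omega)]
    have : (1 + m * (Real.exp (-z) / b - 1)) * b ^ m
        = b ^ m - m * b ^ (m - 1) * (b - Real.exp (-z)) := by
      rw [hbm]; field_simp; ring
    linarith
  have h5 : (m : ℝ) * (m - 1) / 2 * z ^ 2 ≤ (1 + z) ^ m := by
    have : ((m.choose 2 : ℕ) : ℝ) * z ^ 2 ≤ (1 + z) ^ m := by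
      rw [add_comm, add_pow]
      have := Finset.single_le_sum (f := fun i => z ^ i * 1 ^ (m - i) * (m.choose i : ℝ))
        (s := Finset.range (m + 1)) (fun i _ => by positivity)
        (Finset.mem_range.mpr (by omega : 2 < m + 1))
      simpa [mul_comm] using this
    rwa [Nat.cast_choose_two] at this
  have h6 : (1 / (1 + z)) ^ (m - 1) * (1 / (1 + z)) = 1 / (1 + z) ^ m := by
    rw [← pow_succ, Nat.sub_add_cancel (by omega), one_div_pow]
  calc _ ≤ m * (1 / (1 + z)) ^ (m - 1) * (1 / (1 + z) - Real.exp (-z)) := h4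
    _ ≤ m * (1 / (1 + z)) ^ (m - 1) * (1 / (1 + z) * z ^ 2) := by gcongr
    _ = m * ((1 / (1 + z)) ^ (m - 1) * (1 / (1 + z))) * z ^ 2 := by ring
    _ = m * z ^ 2 / (1 + z) ^ m := by rw [h6]; ring
    _ ≤ 2 / ((m : ℝ) - 1) := by
      rw [div_le_div_iff₀ (by positivity) (by linarith)]
      linarith

/-- Rational approximation of the bump function, exact outside `(-1, 1)`. -/
theorem abs_bump_sub_le (y : ℝ) {m : ℕ} (hm : 2 ≤ m) :
    |bump y - (m * max (1 - y ^ 2) 0 / (m * max (1 - y ^ 2) 0 + y ^ 2)) ^ m| ≤ 2 / ((m : ℝ) - 1) := by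
  have hm' : (2 : ℝ) ≤ m := by exact_mod_cast hm
  rcases lt_or_ge |y| 1 with h | h
  · have hs : 0 < 1 - y ^ 2 := by nlinarith [sq_abs y, abs_nonneg y]
    rw [max_eq_left hs.le, bump, if_pos h]
    have := abs_inv_one_add_pow_sub_exp_le (z := y ^ 2 / (1 - y ^ 2) / m) (by positivity) hm
    rwa [mul_div_cancel₀ _ (by positivity), show 1 / (1 + y ^ 2 / (1 - y ^ 2) / m)
      = m * (1 - y ^ 2) / (m * (1 - y ^ 2) + y ^ 2) by field_simp] at this
  · have hs : 1 - y ^ 2 ≤ 0 := by nlinarith [sq_abs y, abs_nonneg y]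
    rw [max_eq_right hs, bump_eq_zero h, mul_zero, zero_div, zero_pow (by omega), sub_self, abs_zero]
    exact div_nonneg zero_le_two (by linarith)

/-! ### Bernstein approximation of Lipschitz functions -/

/-- The Bernstein polynomial of degree `N²` of an `L`-Lipschitz function, with its coefficients
perturbed by at most `δ`, has error at most `δ + L / N` on the unit interval. -/
theorem abs_sub_bernstein_le {g : ℝ → ℝ} {L δ : ℝ} (hL : 0 ≤ L)
    (hg : ∀ x y, |g x - g y| ≤ L * |x - y|) {N : ℕ} (hN : 0 < N) {q : ℕ → ℝ}
    (hq : ∀ i, |q i - g ((i : ℝ) / ((N ^ 2 : ℕ) : ℝ))| ≤ δ) {y : ℝ} (h0 : 0 ≤ y) (h1 : y ≤ 1) :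
    |g y - ∑ i ∈ Finset.range (N ^ 2 + 1),
      q i * (((N ^ 2).choose i : ℝ) * y ^ i * (1 - y) ^ (N ^ 2 - i))| ≤ δ + L / N := by
  set n := N ^ 2 with hn
  have hN' : (0 : ℝ) < N := by exact_mod_cast hN
  have hnN : (n : ℝ) = (N : ℝ) ^ 2 := by rw [hn]; push_cast; ring
  have hn' : (0 : ℝ) < n := by rw [hnN]; positivity
  set b : ℕ → ℝ := fun i => (n.choose i : ℝ) * y ^ i * (1 - y) ^ (n - i) with hb
  have hb0 : ∀ i, 0 ≤ b i := fun i => by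
    have : 0 ≤ 1 - y := by linarith
    positivity
  have hbe : ∀ i, (bernsteinPolynomial ℝ n i).eval y = b i := fun i => by
    simp [bernsteinPolynomial, hb]
  have hsum : ∑ i ∈ Finset.range (n + 1), b i = 1 := by
    have := congrArg (Polynomial.eval y) (bernsteinPolynomial.sum ℝ n)
    simpa [Polynomial.eval_finsetSum, hbe] using this
  have hvar : ∑ i ∈ Finset.range (n + 1), (n * y - i) ^ 2 * b i = n * y * (1 - y) := by
    have := congrArg (Polynomial.eval y) (bernsteinPolynomial.variance ℝ n)
    simpa [Polynomial.eval_finsetSum, hbe] using this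
  have hpt : ∀ i, |g y - q i| ≤ δ + L / (2 * N) + L / (N * n) * (n * y - i) ^ 2 := fun i => by
    have h2 := abs_sub_le (g y) (g (i / n)) (q i)
    have h3 := hq i
    rw [abs_sub_comm] at h3
    have h4 := hg y (i / n)
    -- The inequality of arithmetic and geometric means replaces `|t|` by a multiple of `t ^ 2`.
    have h5 : |y - i / n| ≤ 1 / (2 * N) + 1 / (N * n) * (n * y - i) ^ 2 := by
      have e : 1 / (N * n) * (n * y - i) ^ 2 = N * |y - i / n| ^ 2 := by
        rw [sq_abs]
        have : (n : ℝ) * y - i = n * (y - i / n) := by field_simp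
        rw [this, hnN]
        field_simp
      rw [e]
      set t := |y - i / n|
      have : 1 / (2 * N) + N * t ^ 2 - t = ((2 * N * t - 1) ^ 2 + 1) / (4 * N) := by
        field_simp
        ring
      have : 0 ≤ ((2 * N * t - 1) ^ 2 + 1) / (4 * N) := by positivity
      linarith
    have h6 := mul_le_mul_of_nonneg_left h5 hL
    have : L * (1 / (2 * N) + 1 / (N * n) * (n * y - i) ^ 2)
        = L / (2 * N) + L / (N * n) * (n * y - i) ^ 2 := by ring
    linarith
  have e : g y - ∑ i ∈ Finset.range (n + 1), q i * b i
      = ∑ i ∈ Finset.range (n + 1), (g y - q i) * b i := by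
    simp only [sub_mul, Finset.sum_sub_distrib, ← Finset.mul_sum, hsum, mul_one]
  rw [e]
  calc |∑ i ∈ Finset.range (n + 1), (g y - q i) * b i|
      ≤ ∑ i ∈ Finset.range (n + 1), |(g y - q i) * b i| := Finset.abs_sum_le_sum_abs _ _
    _ ≤ ∑ i ∈ Finset.range (n + 1),
        ((δ + L / (2 * N)) * b i + L / (N * n) * ((n * y - i) ^ 2 * b i)) := by
      refine Finset.sum_le_sum fun i _ => ?_
      rw [abs_mul, abs_of_nonneg (hb0 i)]
      linarith [mul_le_mul_of_nonneg_right (hpt i) (hb0 i)]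
    _ = δ + L / (2 * N) + L / (N * n) * (n * y * (1 - y)) := by
      rw [Finset.sum_add_distrib, ← Finset.mul_sum, ← Finset.mul_sum, hsum, hvar, mul_one]
    _ ≤ δ + L / N := by
      have h7 : L / (N * n) * (n * y * (1 - y)) = L / N * (y * (1 - y)) := by field_simp
      have h8 : y * (1 - y) ≤ 1 / 2 := by nlinarith [sq_nonneg (y - 1 / 2)]
      have h9 := mul_le_mul_of_nonneg_left h8 (by positivity : 0 ≤ L / N)
      have : L / (2 * N) + L / N * (1 / 2) = L / N := by field_simp; norm_num
      linarith

/-! ### The sum of the translated bumps -/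

/-- The function `∑_{k ≥ 2} ψ_k (x - a k)`. -/
noncomputable def bumpSum (a : ℕ → ℕ) (x : ℝ) : ℝ :=
  ∑' k : ℕ, scaledBump (k + 2) (x - (a (k + 2) : ℝ))

/-- The bump at an integer `m ≠ n` vanishes on the interval of radius `5/8` around `n`. These
intervals overlap, so every point is interior to one of them. -/
theorem scaledBump_sub_eq_zero {k : ℕ} {m n : ℤ} (hmn : m ≠ n) {x : ℝ} (hx : |x - n| < 5 / 8) :
    scaledBump (k + 2) (x - m) = 0 := by
  refine scaledBump_eq_zero (by omega) ?_
  have h1 : (1 : ℝ) ≤ |(n : ℝ) - m| := by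
    exact_mod_cast Int.one_le_abs (sub_ne_zero.mpr hmn.symm)
  have h2 := abs_sub_le (n : ℝ) x m
  rw [abs_sub_comm (n : ℝ) x] at h2
  linarith

section

variable {a : ℕ → ℕ}

theorem hasSum_bump_of_eq (ha : Function.Injective a) {k : ℕ} {n : ℤ} (hk : (a (k + 2) : ℤ) = n)
    {x : ℝ} (hx : |x - n| < 5 / 8) :
    HasSum (fun k : ℕ => scaledBump (k + 2) (x - (a (k + 2) : ℝ))) (scaledBump (k + 2) (x - n)) := by
  have h := hasSum_single (f := fun k : ℕ => scaledBump (k + 2) (x - (a (k + 2) : ℝ))) k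
    fun j hj => by
      have hne : (a (j + 2) : ℤ) ≠ n := fun h => hj (by
        have := ha (Int.ofNat.inj (h.trans hk.symm))
        omega)
      exact_mod_cast scaledBump_sub_eq_zero hne hx
  have e : (a (k + 2) : ℝ) = n := by exact_mod_cast congrArg (Int.cast : ℤ → ℝ) hk
  simpa only [e] using h

theorem hasSum_bump_of_ne {n : ℤ} (hn : ∀ k, (a (k + 2) : ℤ) ≠ n) {x : ℝ} (hx : |x - n| < 5 / 8) :
    HasSum (fun k : ℕ => scaledBump (k + 2) (x - (a (k + 2) : ℝ))) 0 := by
  have : (fun k : ℕ => scaledBump (k + 2) (x - (a (k + 2) : ℝ))) = fun _ => 0 :=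
    funext fun k => by exact_mod_cast scaledBump_sub_eq_zero (hn k) hx
  rw [this]
  exact hasSum_zero

theorem abs_sub_round_lt (x : ℝ) : |x - (round x : ℤ)| < 5 / 8 :=
  (abs_sub_round x).trans_lt (by norm_num)

theorem hasSum_bumpSum (ha : Function.Injective a) (x : ℝ) :
    HasSum (fun k : ℕ => scaledBump (k + 2) (x - (a (k + 2) : ℝ))) (bumpSum a x) := by
  refine Summable.hasSum ?_
  by_cases h : ∃ k, (a (k + 2) : ℤ) = round x
  · obtain ⟨k, hk⟩ := h
    exact (hasSum_bump_of_eq ha hk (abs_sub_round_lt x)).summable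
  · exact (hasSum_bump_of_ne (not_exists.mp h) (abs_sub_round_lt x)).summable

theorem eventually_abs_sub_lt_of_lt {x c : ℝ} (h : |x - c| < 5 / 8) : ∀ᶠ y in 𝓝 x, |y - c| < 5 / 8 :=
  (isOpen_lt (continuous_id.sub continuous_const).abs continuous_const).mem_nhds h

theorem bumpSum_eventuallyEq_of_eq (ha : Function.Injective a) {k : ℕ} {n : ℤ}
    (hk : (a (k + 2) : ℤ) = n) {x : ℝ} (hx : |x - n| < 5 / 8) :
    bumpSum a =ᶠ[𝓝 x] fun y => scaledBump (k + 2) (y - n) := by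
  filter_upwards [eventually_abs_sub_lt_of_lt hx] with y hy
  exact (hasSum_bump_of_eq ha hk hy).tsum_eq

theorem bumpSum_eventuallyEq_of_ne {n : ℤ} (hn : ∀ k, (a (k + 2) : ℤ) ≠ n) {x : ℝ}
    (hx : |x - n| < 5 / 8) : bumpSum a =ᶠ[𝓝 x] fun _ => 0 := by
  filter_upwards [eventually_abs_sub_lt_of_lt hx] with y hy
  exact (hasSum_bump_of_ne hn hy).tsum_eq

theorem contDiff_bumpSum (ha : Function.Injective a) : ContDiff ℝ ∞ (bumpSum a) := by
  refine contDiff_iff_contDiffAt.mpr fun x => ?_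
  by_cases h : ∃ k, (a (k + 2) : ℤ) = round x
  · obtain ⟨k, hk⟩ := h
    exact ContDiffAt.congr_of_eventuallyEq
      ((contDiff_scaledBump (k + 2)).comp (contDiff_id.sub contDiff_const)).contDiffAt
      (bumpSum_eventuallyEq_of_eq ha hk (abs_sub_round_lt x))
  · exact contDiffAt_const.congr_of_eventuallyEq
      (bumpSum_eventuallyEq_of_ne (not_exists.mp h) (abs_sub_round_lt x))

theorem two_le_deriv_bumpSum (ha : Function.Injective a) (k : ℕ) :
    2 ≤ deriv (bumpSum a) (a (k + 2)) := by
  obtain ⟨c, hc1, hc⟩ := exists_hasDerivAt_bump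
  have e : (((a (k + 2) : ℕ) : ℤ) : ℝ) = a (k + 2) := by norm_cast
  have h1 := bumpSum_eventuallyEq_of_eq ha (k := k) (n := (a (k + 2) : ℤ)) rfl
    (x := (a (k + 2) : ℝ)) (by rw [e, sub_self, abs_zero]; norm_num)
  have h2 : HasDerivAt (scaledBump (k + 2)) ((k + 2 : ℕ) * c)
      ((a (k + 2) : ℝ) - ((a (k + 2) : ℤ) : ℝ)) := by
    rw [e, sub_self]
    exact hasDerivAt_scaledBump hc (by omega)
  rw [h1.deriv_eq, (h2.comp_sub_const _ _).deriv]
  push_cast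
  have : (0 : ℝ) ≤ k := k.cast_nonneg
  nlinarith

theorem deriv_bumpSum_eq_zero {n : ℕ} (hn : ∀ k, a (k + 2) ≠ n) : deriv (bumpSum a) n = 0 := by
  have e : ((n : ℤ) : ℝ) = n := by norm_cast
  have h1 := bumpSum_eventuallyEq_of_ne (a := a) (n := (n : ℤ))
    (fun k h => hn k (Int.ofNat.inj h)) (x := (n : ℝ)) (by rw [e, sub_self, abs_zero]; norm_num)
  rw [h1.deriv_eq, deriv_const]

/-- Since the bumps have disjoint supports, the error of a partial sum is at most the height of
the first omitted bump. -/
theorem abs_bumpSum_sub_sum_le (ha : Function.Injective a) (N : ℕ) (x : ℝ) :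
    |bumpSum a x - ∑ k ∈ Finset.range N, scaledBump (k + 2) (x - (a (k + 2) : ℝ))|
      ≤ 1 / ((N : ℝ) + 2) := by
  have hx := abs_sub_round_lt x
  have h0 : (0 : ℝ) ≤ 1 / ((N : ℝ) + 2) := by positivity
  by_cases h : ∃ k, (a (k + 2) : ℤ) = round x
  · obtain ⟨k, hk⟩ := h
    have h1 : bumpSum a x = scaledBump (k + 2) (x - round x) := (hasSum_bump_of_eq ha hk hx).tsum_eq
    have h2 : ∀ j, j ≠ k → scaledBump (j + 2) (x - (a (j + 2) : ℝ)) = 0 := fun j hj => by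
      have hne : (a (j + 2) : ℤ) ≠ round x := fun h => hj (by
        have := ha (Int.ofNat.inj (h.trans hk.symm))
        omega)
      exact_mod_cast scaledBump_sub_eq_zero hne hx
    have e : (a (k + 2) : ℝ) = (round x : ℤ) := by exact_mod_cast congrArg (Int.cast : ℤ → ℝ) hk
    rcases lt_or_ge k N with hkN | hkN
    · rw [Finset.sum_eq_single k (fun j _ hj => h2 j hj)
        (fun h => absurd (Finset.mem_range.mpr hkN) h), h1, e, sub_self, abs_zero]
      exact h0
    · rw [Finset.sum_eq_zero fun j hj => h2 j (by have := Finset.mem_range.mp hj; omega), sub_zero,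
        h1, abs_of_nonneg (scaledBump_nonneg _ _)]
      refine (scaledBump_le _ _).trans (one_div_le_one_div_of_le (by positivity) ?_)
      have : (N : ℝ) ≤ k := by exact_mod_cast hkN
      push_cast
      linarith
  · have h1 : bumpSum a x = 0 := (hasSum_bump_of_ne (not_exists.mp h) hx).tsum_eq
    rw [h1, Finset.sum_eq_zero fun j _ => ?_, sub_zero, abs_zero]
    · exact h0
    · exact_mod_cast scaledBump_sub_eq_zero (not_exists.mp h j) hx

end

/-! ### Computability of the sum -/

/-- The numerator of `|k² (2ˡ (2 i / n - 1) - A) - 1/2|` over the denominator `2 n`. -/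
def nodeNum (k A l n i : ℕ) : ℕ :=
  (k ^ 2 * 2 ^ (l + 2) * i - (2 * k ^ 2 * 2 ^ l * n + 2 * k ^ 2 * A * n + n)) +
    ((2 * k ^ 2 * 2 ^ l * n + 2 * k ^ 2 * A * n + n) - k ^ 2 * 2 ^ (l + 2) * i)

/-- A rational approximation of `ψ_k (x - A)` at the node `x = 2ˡ (2 i / n - 1)`. The truncated
subtraction is the maximum of the difference with `0`. -/
def nodeValue (k A l n m i : ℕ) : ℚ :=
  (((m * ((2 * n) ^ 2 - nodeNum k A l n i ^ 2)) ^ m : ℕ) : ℚ) /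
    ((k * (m * ((2 * n) ^ 2 - nodeNum k A l n i ^ 2) + nodeNum k A l n i ^ 2) ^ m : ℕ) : ℚ)

theorem node_den_pos {n m : ℕ} (hn : 0 < n) (hm : 0 < m) (M : ℕ) :
    0 < m * ((2 * n) ^ 2 - M ^ 2) + M ^ 2 := by
  rcases Nat.eq_zero_or_pos M with rfl | hM
  · have : (2 * n) ^ 2 - 0 ^ 2 = (2 * n) ^ 2 := by simp
    rw [this]
    positivity
  · positivity

theorem abs_nodeValue_sub_le {k A l n m i : ℕ} (hk : 0 < k) (hn : 0 < n) (hm : 2 ≤ m) :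
    |(nodeValue k A l n m i : ℝ) - scaledBump k (2 ^ l * (2 * ((i : ℝ) / n) - 1) - A)|
      ≤ 2 / ((m : ℝ) - 1) := by
  have hn' : (0 : ℝ) < n := by exact_mod_cast hn
  have hk' : (1 : ℝ) ≤ k := by exact_mod_cast hk
  set y : ℝ := (k : ℝ) ^ 2 * (2 ^ l * (2 * ((i : ℝ) / n) - 1) - A) - 1 / 2 with hy
  set M := nodeNum k A l n i with hM
  have hM2 : (M : ℝ) ^ 2 = (2 * n) ^ 2 * y ^ 2 := by
    have habs : (M : ℝ) = |(2 * n) * y| := by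
      have e : 2 * (n : ℝ) * y = ((k ^ 2 * 2 ^ (l + 2) * i : ℕ) : ℝ)
          - ((2 * k ^ 2 * 2 ^ l * n + 2 * k ^ 2 * A * n + n : ℕ) : ℝ) := by
        rw [hy]
        push_cast
        field_simp
        ring
      rw [e, hM, nodeNum]
      generalize k ^ 2 * 2 ^ (l + 2) * i = u
      generalize 2 * k ^ 2 * 2 ^ l * n + 2 * k ^ 2 * A * n + n = v
      rcases le_total u v with h | h
      · have h' : (u : ℝ) ≤ v := by exact_mod_cast h
        rw [Nat.sub_eq_zero_of_le h, zero_add, Nat.cast_sub h, abs_sub_comm,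
          abs_of_nonneg (sub_nonneg.mpr h')]
      · have h' : (v : ℝ) ≤ u := by exact_mod_cast h
        rw [Nat.sub_eq_zero_of_le h, add_zero, Nat.cast_sub h,
          abs_of_nonneg (sub_nonneg.mpr h')]
    rw [habs, sq_abs, mul_pow]
  have hS : (((2 * n) ^ 2 - M ^ 2 : ℕ) : ℝ) = (2 * n) ^ 2 * max (1 - y ^ 2) 0 := by
    rw [mul_max_of_nonneg _ _ (by positivity), mul_zero, mul_sub, mul_one, ← hM2]
    rcases le_total (M ^ 2) ((2 * n) ^ 2) with h | h
    · have h' : (M : ℝ) ^ 2 ≤ (2 * n) ^ 2 := by exact_mod_cast h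
      rw [Nat.cast_sub h, max_eq_left (sub_nonneg.mpr h')]
      push_cast
      rfl
    · have h' : (2 * n : ℝ) ^ 2 ≤ (M : ℝ) ^ 2 := by exact_mod_cast h
      rw [Nat.sub_eq_zero_of_le h, max_eq_right (sub_nonpos.mpr h'), Nat.cast_zero]
  have hval : (nodeValue k A l n m i : ℝ) = 1 / k *
      (m * max (1 - y ^ 2) 0 / (m * max (1 - y ^ 2) 0 + y ^ 2)) ^ m := by
    have e1 : (m : ℝ) * ((2 * n) ^ 2 * max (1 - y ^ 2) 0) =
        (2 * n) ^ 2 * (m * max (1 - y ^ 2) 0) := by ring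
    rw [nodeValue, ← hM]
    rw [Rat.cast_div, Rat.cast_natCast, Rat.cast_natCast, Nat.cast_mul k, Nat.cast_pow, Nat.cast_pow,
      Nat.cast_add, Nat.cast_mul m, Nat.cast_pow M, hS, hM2, e1, ← mul_add]
    have hQ : (2 * (n : ℝ)) ^ 2 ≠ 0 := by positivity
    rw [mul_pow (_ ^ 2), mul_pow (_ ^ 2), mul_left_comm, mul_div_mul_left _ _ (pow_ne_zero m hQ),
      div_pow, one_div, div_mul_eq_div_div, ← div_eq_inv_mul, div_right_comm]
  rw [hval, scaledBump, ← mul_sub, abs_mul, abs_sub_comm, abs_of_pos (by positivity)]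
  calc 1 / (k : ℝ) * _ ≤ 1 * (2 / ((m : ℝ) - 1)) :=
        mul_le_mul ((div_le_one (by positivity)).mpr hk') (abs_bump_sub_le y hm) (abs_nonneg _)
          zero_le_one
    _ = _ := one_mul _

open Polynomial in
/-- The Bernstein polynomial of degree `N²` of `ψ_k (x - A)` on the interval `[-2ˡ, 2ˡ]`, with
rational approximations of the values at the nodes. Natural numbers are written as quotients, the
form in which `PolyComputable.natDiv` takes them. -/
noncomputable def bumpPoly (k A l N m : ℕ) : ℚ[X] :=
  ∑ i ∈ Finset.range (N ^ 2 + 1), C (nodeValue k A l (N ^ 2) m i) *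
    (C (((N ^ 2).choose i : ℕ) / ((1 : ℕ) : ℚ)) *
      (C (1 / 2) + C ((1 : ℕ) / ((2 ^ (l + 1) : ℕ) : ℚ)) * X) ^ i *
      (C (1 / 2) + C (-1) * (C ((1 : ℕ) / ((2 ^ (l + 1) : ℕ) : ℚ)) * X)) ^ (N ^ 2 - i))

theorem abs_scaledBump_sub_bumpPoly_le {K : ℕ} (hK : ∀ x y, |bump x - bump y| ≤ K * |x - y|)
    {k A l N m : ℕ} (hk : 0 < k) (hN : 0 < N) (hm : 2 ≤ m) {x : ℝ} (hx : |x| ≤ 2 ^ l) :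
    |scaledBump k (x - A) - Polynomial.aeval x (bumpPoly k A l N m)|
      ≤ 2 / ((m : ℝ) - 1) + K * k * 2 ^ (l + 1) / N := by
  have h2 : (0 : ℝ) < 2 ^ l := by positivity
  have hlip : ∀ u v : ℝ, |scaledBump k (2 ^ l * (2 * u - 1) - A)
      - scaledBump k (2 ^ l * (2 * v - 1) - A)| ≤ K * k * 2 ^ (l + 1) * |u - v| := fun u v => by
    refine (scaledBump_lipschitz hK k _ _).trans (le_of_eq ?_)
    rw [show (2 : ℝ) ^ l * (2 * u - 1) - A - (2 ^ l * (2 * v - 1) - A) = 2 ^ (l + 1) * (u - v) by ring,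
      abs_mul, abs_of_pos (by positivity : (0 : ℝ) < 2 ^ (l + 1))]
    ring
  obtain ⟨hx1, hx2⟩ := abs_le.mp hx
  have hy0 : 0 ≤ 1 / 2 + x / 2 ^ (l + 1) := by
    rw [pow_succ, ← div_div]
    have : -1 ≤ x / 2 ^ l := by rw [le_div_iff₀ h2]; linarith
    linarith
  have hy1 : 1 / 2 + x / 2 ^ (l + 1) ≤ 1 := by
    rw [pow_succ, ← div_div]
    have : x / 2 ^ l ≤ 1 := by rw [div_le_iff₀ h2]; linarith
    linarith
  have h := abs_sub_bernstein_le (by positivity) hlip hN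
    (fun i => abs_nodeValue_sub_le (i := i) hk (pow_pos hN 2) hm) hy0 hy1
  have e1 : (2 : ℝ) ^ l * (2 * (1 / 2 + x / 2 ^ (l + 1)) - 1) = x := by
    rw [pow_succ]
    field_simp
    ring
  have e2 : Polynomial.aeval x (bumpPoly k A l N m) = ∑ i ∈ Finset.range (N ^ 2 + 1),
      (nodeValue k A l (N ^ 2) m i : ℝ) * (((N ^ 2).choose i : ℝ) *
        (1 / 2 + x / 2 ^ (l + 1)) ^ i * (1 - (1 / 2 + x / 2 ^ (l + 1))) ^ (N ^ 2 - i)) := by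
    rw [bumpPoly, map_sum]
    refine Finset.sum_congr rfl fun i _ => ?_
    have e3 : (1 : ℝ) - (1 / 2 + x / 2 ^ (l + 1)) = 1 / 2 + -1 * (1 / 2 ^ (l + 1) * x) := by ring
    have e4 : x / 2 ^ (l + 1) = 1 / 2 ^ (l + 1) * x := by ring
    rw [e3, e4]
    simp
  rwa [e1, ← e2] at h

theorem polyComputable_bumpPoly {α : Type*} [Primcodable α] {k A l N m : α → ℕ}
    (hk : Computable k) (hA : Computable A) (hl : Computable l) (hN : Computable N)
    (hm : Computable m) (hk0 : ∀ x, 0 < k x) (hN0 : ∀ x, 0 < N x) (hm0 : ∀ x, 0 < m x) :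
    PolyComputable fun x => bumpPoly (k x) (A x) (l x) (N x) (m x) := by
  have hc : ∀ {β : Type _} [Primcodable β] (n : ℕ), Computable fun _ : β => n := fun n =>
    Computable.const n
  have hn : Computable fun x => N x ^ 2 := hN.nat_pow' (hc 2)
  refine PolyComputable.sum (H := fun x i => _) ?_ (hn.nat_add' (hc 1))
  have hi : Computable fun s : α × ℕ => s.2 := Computable.snd
  replace hn : Computable fun s : α × ℕ => N s.1 ^ 2 := hn.comp Computable.fst
  replace hk : Computable fun s : α × ℕ => k s.1 := hk.comp Computable.fst
  replace hA : Computable fun s : α × ℕ => A s.1 := hA.comp Computable.fst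
  replace hl : Computable fun s : α × ℕ => l s.1 := hl.comp Computable.fst
  replace hm : Computable fun s : α × ℕ => m s.1 := hm.comp Computable.fst
  have hk2 := hk.nat_pow' (hc 2)
  have hu := (hk2.nat_mul' ((hc 2).nat_pow' (hl.nat_add' (hc 2)))).nat_mul' hi
  have hv := (((((hc 2).nat_mul' hk2).nat_mul' ((hc 2).nat_pow' hl)).nat_mul' hn).nat_add'
    ((((hc 2).nat_mul' hk2).nat_mul' hA).nat_mul' hn)).nat_add' hn
  have hM : Computable fun s : α × ℕ => nodeNum (k s.1) (A s.1) (l s.1) (N s.1 ^ 2) s.2 :=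
    (hu.nat_sub' hv).nat_add' (hv.nat_sub' hu)
  have hM2 := hM.nat_pow' (hc 2)
  have hS := hm.nat_mul' ((((hc 2).nat_mul' hn).nat_pow' (hc 2)).nat_sub' hM2)
  have hvalue := PolyComputable.natDiv (hS.nat_pow' hm)
    (hk.nat_mul' ((hS.nat_add' hM2).nat_pow' hm)) fun s => (Nat.mul_pos (hk0 s.1)
      (Nat.pow_pos (node_den_pos (pow_pos (hN0 s.1) 2) (hm0 s.1) _))).ne'
  have hchoose := PolyComputable.natDiv (hn.nat_choose' hi) (hc 1) fun _ => one_ne_zero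
  have hscale := (PolyComputable.natDiv (hc 1) ((hc 2).nat_pow' (hl.nat_add' (hc 1)))
    fun _ => (by positivity)).mul (PolyComputable.const Polynomial.X)
  have hhalf := PolyComputable.const (α := α × ℕ) (Polynomial.C (1 / 2))
  exact hvalue.mul ((hchoose.mul ((hhalf.add hscale).pow hi)).mul
    ((hhalf.add ((PolyComputable.const (Polynomial.C (-1))).mul hscale)).pow (hn.nat_sub' hi)))

theorem exists_computable_name_bumpSum {a : ℕ → ℕ} (hac : Computable a)
    (ha : Function.Injective a) :
    ∃ p : ℕ → List (ℕ × ℕ × ℕ), Computable p ∧ ∀ k l : ℕ, ∀ x : ℝ, |x| ≤ 2 ^ l →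
      |bumpSum a x - Polynomial.aeval x (polyOfCode (p (Nat.pair k l)))| < (1 / 2) ^ k := by
  obtain ⟨K, hK0, hK⟩ := exists_lipschitz_bump
  -- Precision `(1 / 2) ^ e` is asked for. The first `2 ^ (e + 1)` bumps are approximated, each with
  -- error at most `1 / T e`: half of it from the nodes, half from the Bernstein polynomial of
  -- degree `N ^ 2`. These errors add up to `(1 / 2) ^ e / 4`, the omitted bumps contribute
  -- at most `(1 / 2) ^ e / 2`.
  let T : ℕ → ℕ := fun e => 2 ^ (2 * e + 3)
  let N : ℕ → ℕ → ℕ → ℕ := fun e l j => 2 * T e * (K * (j + 2) * 2 ^ (l + 1))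
  have hT0 : ∀ e, 0 < T e := fun e => by positivity
  have hN0 : ∀ e l j, 0 < N e l j := fun e l j => by positivity
  have hF : PolyComputable fun s : ℕ × ℕ => ∑ j ∈ Finset.range (2 ^ (s.1 + 1)),
      bumpPoly (j + 2) (a (j + 2)) s.2 (N s.1 s.2 j) (4 * T s.1 + 2) := by
    have hc : ∀ {β : Type} [Primcodable β] (n : ℕ), Computable fun _ : β => n := fun n =>
      Computable.const n
    refine PolyComputable.sum (H := fun s j => _) ?_
      ((hc 2).nat_pow' (Computable.fst.nat_add' (hc 1)))
    have hj : Computable fun s : (ℕ × ℕ) × ℕ => s.2 + 2 := Computable.snd.nat_add' (hc 2)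
    have hl : Computable fun s : (ℕ × ℕ) × ℕ => s.1.2 := Computable.snd.comp Computable.fst
    have hT : Computable fun s : (ℕ × ℕ) × ℕ => T s.1.1 := (hc 2).nat_pow'
      (((hc 2).nat_mul' (Computable.fst.comp Computable.fst)).nat_add' (hc 3))
    exact polyComputable_bumpPoly hj (hac.comp hj) hl
      (((hc 2).nat_mul' hT).nat_mul' (((hc K).nat_mul' hj).nat_mul'
        ((hc 2).nat_pow' (hl.nat_add' (hc 1)))))
      (((hc 4).nat_mul' hT).nat_add' (hc 2)) (fun s => by positivity) (fun s => hN0 _ _ _)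
      (fun s => by positivity)
  obtain ⟨c, hc, hcF⟩ := hF
  refine ⟨fun n => c n.unpair, hc.comp Computable.unpair, fun e l x hx => ?_⟩
  simp only [Nat.unpair_pair, hcF, map_sum]
  have hT' : (0 : ℝ) < T e := by exact_mod_cast hT0 e
  have hterm : ∀ j, |scaledBump (j + 2) (x - (a (j + 2) : ℝ)) - Polynomial.aeval x
      (bumpPoly (j + 2) (a (j + 2)) l (N e l j) (4 * T e + 2))| ≤ 1 / T e := fun j => by
    refine (abs_scaledBump_sub_bumpPoly_le hK (by omega) (hN0 e l j) (by omega) hx).trans ?_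
    have hP : (0 : ℝ) < K * ((j + 2 : ℕ) : ℝ) * 2 ^ (l + 1) := by
      have : (0 : ℝ) < K := by exact_mod_cast hK0
      positivity
    have h1 : (K : ℝ) * ((j + 2 : ℕ) : ℝ) * 2 ^ (l + 1) / (N e l j : ℕ) = 1 / (2 * T e) := by
      have : ((N e l j : ℕ) : ℝ) = 2 * T e * (K * ((j + 2 : ℕ) : ℝ) * 2 ^ (l + 1)) := by
        simp only [N]
        push_cast
        ring
      rw [this]
      field_simp
    have h2 : 2 / (((4 * T e + 2 : ℕ) : ℝ) - 1) ≤ 1 / (2 * T e) := by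
      push_cast
      rw [div_le_div_iff₀ (by linarith) (by positivity)]
      linarith
    have h3 : 1 / (T e : ℝ) = 1 / (2 * T e) + 1 / (2 * T e) := by
      field_simp
      norm_num
    rw [h1, h3]
    linarith
  have hsum : |∑ j ∈ Finset.range (2 ^ (e + 1)), scaledBump (j + 2) (x - (a (j + 2) : ℝ))
      - ∑ j ∈ Finset.range (2 ^ (e + 1)), Polynomial.aeval x
        (bumpPoly (j + 2) (a (j + 2)) l (N e l j) (4 * T e + 2))| ≤ 2 ^ (e + 1) / T e := by
    rw [← Finset.sum_sub_distrib]
    refine (Finset.abs_sum_le_sum_abs _ _).trans ((Finset.sum_le_sum fun j _ => hterm j).trans ?_)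
    simp [div_eq_mul_inv]
  have htail := abs_bumpSum_sub_sum_le ha (2 ^ (e + 1)) x
  have h4 : (2 : ℝ) ^ (e + 1) / T e = (1 / 2) ^ e / 4 := by
    simp only [T]
    push_cast
    rw [one_div, inv_pow]
    field_simp
    ring
  have h5 : 1 / (((2 ^ (e + 1) : ℕ) : ℝ) + 2) ≤ (1 / 2) ^ e / 2 := by
    have : (1 / 2 : ℝ) ^ e / 2 = 1 / 2 ^ (e + 1) := by
      rw [one_div, inv_pow]
      field_simp
      ring
    rw [this]
    push_cast
    exact one_div_le_one_div_of_le (by positivity) (by linarith)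
  have h6 : (0 : ℝ) < (1 / 2) ^ e := by positivity
  refine (abs_sub_le _ (∑ j ∈ Finset.range (2 ^ (e + 1)),
    scaledBump (j + 2) (x - (a (j + 2) : ℝ))) _).trans_lt ?_
  linarith

/-! ### Noncomputability of the derivative -/

theorem aeval_natCast_polyOfCode (L : List (ℕ × ℕ × ℕ)) (n : ℕ) :
    Polynomial.aeval (n : ℝ) (polyOfCode L) = (ratOfCode (evalCode L (n, 0, 0)) : ℝ) := by
  rw [ratOfCode_evalCode]
  simpa [ratOfCode] using Polynomial.aeval_algebraMap_apply ℝ (n : ℚ) (polyOfCode L)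

theorem one_lt_ratOfCode_iff (c : ℕ × ℕ × ℕ) :
    1 < ratOfCode c ↔ c.2.1 + (c.2.2 + 1) < c.1 := by
  rw [ratOfCode, lt_div_iff₀ (by positivity), one_mul, lt_sub_iff_add_lt]
  constructor <;> intro h
  · have : c.2.2 + 1 + c.2.1 < c.1 := by exact_mod_cast h
    omega
  · have : c.2.2 + 1 + c.2.1 < c.1 := by omega
    exact_mod_cast this

/-- A computable function whose values at the natural numbers are bounded away from the
threshold `1` decides on which side of the threshold they lie. -/
theorem computablePred_of_separated {h : C(ℝ, ℝ)} (hh : continuousRep.IsComputable h)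
    {S : Set ℕ} (h1 : ∀ n ∈ S, 5 / 4 ≤ h n) (h0 : ∀ n ∉ S, h n ≤ 3 / 4) :
    ComputablePred fun n : ℕ => n ∈ S := by
  classical
  obtain ⟨p, hp, hname⟩ := hh
  have hv : Computable fun n : ℕ => evalCode (p (Nat.pair 2 n)) (n, 0, 0) :=
    primrec_evalCode.to_comp.comp
      (hp.comp (Primrec₂.natPair.to_comp.comp (Computable.const 2) Computable.id))
      (Computable.id.pair (Computable.const (0, 0)))
  have hdec : Computable fun c : ℕ × ℕ × ℕ => decide (c.2.1 + (c.2.2 + 1) < c.1) :=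
    (Primrec.nat_lt.decide.comp (Primrec.nat_add.comp (Primrec.fst.comp Primrec.snd)
      (Primrec.succ.comp (Primrec.snd.comp Primrec.snd))) Primrec.fst).to_comp
  refine ComputablePred.of_eq (ComputablePred.computable_iff.2 ⟨_, hdec.comp hv, rfl⟩) fun n => ?_
  have hn : |(n : ℝ)| ≤ 2 ^ n := by
    rw [abs_of_nonneg n.cast_nonneg]
    exact_mod_cast Nat.lt_two_pow_self.le
  have hclose := abs_lt.mp (hname 2 n n hn)
  rw [aeval_natCast_polyOfCode] at hclose
  simp only [decide_eq_true_eq]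
  rw [← one_lt_ratOfCode_iff]
  constructor
  · intro hlt
    by_contra hS
    have hlt' : (1 : ℝ) < (ratOfCode (evalCode (p (Nat.pair 2 n)) (n, 0, 0)) : ℝ) := by
      exact_mod_cast hlt
    linarith [h0 n hS, hclose.1]
  · intro hS
    have : (1 : ℝ) < (ratOfCode (evalCode (p (Nat.pair 2 n)) (n, 0, 0)) : ℝ) := by
      linarith [h1 n hS, hclose.2]
    exact_mod_cast this

theorem IsInjEnumOfNonrecursive.not_computablePred_tail {a : ℕ → ℕ}
    (ha : IsInjEnumOfNonrecursive a) :
    ¬ ComputablePred fun n : ℕ => n ∈ Set.range fun k => a (k + 2) := by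
  intro h
  obtain ⟨f, hf, hfe⟩ := ComputablePred.computable_iff.1 h
  refine ha.nonrecursive (ComputablePred.of_eq (ComputablePred.computable_iff.2
    ⟨fun n => f n || (n == a 0 || n == a 1), ?_, rfl⟩) fun n => ?_)
  · exact Primrec.or.to_comp.comp hf (Primrec.or.comp
      (Primrec.beq.comp Primrec.id (Primrec.const (a 0)))
      (Primrec.beq.comp Primrec.id (Primrec.const (a 1)))).to_comp
  · have hn : (n ∈ Set.range fun k => a (k + 2)) ↔ f n = true := iff_of_eq (congrFun hfe n)
    simp only [Bool.or_eq_true, beq_iff_eq, ← hn]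
    constructor
    · rintro (⟨k, rfl⟩ | rfl | rfl)
      exacts [⟨_, rfl⟩, ⟨_, rfl⟩, ⟨_, rfl⟩]
    · rintro ⟨_ | _ | k, rfl⟩
      exacts [Or.inr (Or.inl rfl), Or.inr (Or.inr rfl), Or.inl ⟨k, rfl⟩]

theorem C1R.abs_deriv_sub_le_dist {f g : C1R} (h : dist f g < 1) (x : ℝ) :
    |deriv f.1 x - deriv g.1 x| ≤ dist f g := by
  have hd : dist f g = (min (normSub f g) 1).toReal := rfl
  have hlt : normSub f g < 1 := by
    by_contra hge
    rw [hd, min_eq_right (not_lt.mp hge)] at h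
    simp at h
  rw [hd, min_eq_left hlt.le, ← Real.norm_eq_abs, ← toReal_enorm]
  exact ENNReal.toReal_mono hlt.ne_top ((le_max_right _ _).trans
    (le_iSup (fun x : ℝ => max ‖f x - g x‖ₑ ‖deriv f.1 x - deriv g.1 x‖ₑ) x))

theorem not_isComputable_D_of_dist_lt {a : ℕ → ℕ} (ha : IsInjEnumOfNonrecursive a) {f g : C1R}
    (hf : f.1 = bumpSum a) (hg : dist g f < 1 / 2) : ¬ continuousRep.IsComputable (C1R.D g) := by
  intro hcomp
  have hclose : ∀ x, |deriv g.1 x - deriv (bumpSum a) x| < 1 / 2 := fun x =>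
    hf ▸ (C1R.abs_deriv_sub_le_dist (hg.trans (by norm_num)) x).trans_lt hg
  refine ha.not_computablePred_tail (computablePred_of_separated hcomp ?_ fun n hn => ?_)
  · rintro _ ⟨k, rfl⟩
    have h1 := two_le_deriv_bumpSum ha.injective k
    have h2 := (abs_lt.mp (hclose (a (k + 2)))).1
    change 5 / 4 ≤ deriv g.1 (a (k + 2))
    linarith
  · have h1 := deriv_bumpSum_eq_zero (a := a) (n := n) fun k hk => hn ⟨k, hk⟩
    have h2 := (abs_lt.mp (hclose n)).2
    change deriv g.1 n ≤ 3 / 4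
    linarith

/-- Nonrecursive r.e. sets with recursive one-to-one enumerations `a` exist, and for each of them
the sum `f(x) = ∑_{k ≥ 2} ψ_k(x - a(k))` is a computable `C^∞` function at which differentiation
`D : C¹(ℝ) → C(ℝ)` is robustly non-computable (for the uniform `C¹` topology). -/
theorem mainTheorem1 :
    (∃ a : ℕ → ℕ, IsInjEnumOfNonrecursive a) ∧
    ∀ a : ℕ → ℕ, IsInjEnumOfNonrecursive a →
      ∃ f : C1R,
        (∀ x : ℝ, HasSum (fun k : ℕ => scaledBump (k + 2) (x - (a (k + 2) : ℝ))) (f x)) ∧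
        ContDiff ℝ ∞ (f : ℝ → ℝ) ∧
        RobustlyNonComputableAt C1R.rep continuousRep (inferInstance : TopologicalSpace C1R) C1R.D f := by
  refine ⟨exists_injEnumOfNonrecursive, fun a ha => ?_⟩
  have hsmooth := contDiff_bumpSum ha.injective
  let f : C1R := ⟨bumpSum a, hsmooth.of_le (by simp)⟩
  refine ⟨f, hasSum_bumpSum ha.injective, hsmooth, ?_, ?_, Metric.ball f (1 / 2),
    Metric.isOpen_ball, Metric.mem_ball_self (by norm_num), fun g hg => ?_⟩
  · exact exists_computable_name_bumpSum ha.computable ha.injective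
  · exact not_isComputable_D_of_dist_lt ha rfl (by rw [dist_self]; norm_num)
  · exact not_isComputable_D_of_dist_lt ha rfl hg
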